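/- Let $\Sigma$ be a simplicial fan in $\mathbb{R}^n$ (a finite nonempty collection of strongly convex cones, rational with respect to $\mathbb{Z}^n$, that is closed under taking faces, in which any two cones meet in a common face, and each of whose cones is generated by linearly independent vectors). Let $X$ be the associated simplicial toric variety over $\mathbb{C}$, obtained by gluing the affine charts $U_\sigma=\operatorname{Spec}\mathbb{C}[\sigma^\vee\cap\mathbb{Z}^n]$, $\sigma\in\Sigma$, and let $D_1,\dots,D_r$ be prime torus-invariant Weil divisors on $X$, that is, irreducible closed subsets of codimension one that are stable under the torus $(\mathbb{C}^*)^n$, each given its reduced closed subscheme structure. Let $D=D_1\cup\dots\cup D_r$ be the closed subscheme whose ideal sheaf is the intersection of the ideal sheaves of the $D_i$, and for $1\le i_0<\dots<i_p\le r$ let $D_{i_0}\cap\dots\cap D_{i_p}$ be the scheme-theoretic intersection, whose ideal sheaf is the sum of the ideal sheaves of $D_{i_0},\dots,D_{i_p}$. Then the Mayer–Vietoris sheaf sequence $$0\longrightarrow \mathcal{O}_D\longrightarrow\bigoplus_{i}\mathcal{O}_{D_i}\longrightarrow\bigoplus_{i<j}\mathcal{O}_{D_i\cap D_j}\longrightarrow\cdots\longrightarrow\mathcal{O}_{D_1\cap\dots\cap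 D_r}\longrightarrow 0,$$ whose first map is the restriction and whose further differentials are $$(d\varphi)_{i_0\dots i_{p+1}}=\sum_{j=0}^{p+1}(-1)^j\,\varphi_{i_0\dots\widehat{i_j}\dots i_{p+1}}\big|_{D_{i_0}\cap\dots\cap D_{i_{p+1}}},$$ is an exact sequence of $\mathcal{O}_X$-modules. -/

import Mathlib

open CategoryTheory CategoryTheory.Limits AlgebraicGeometry TopologicalSpace

noncomputable section

/-! ## Toric varieties

The lattice of one-parameter subgroups is `N = ℤⁿ`, with `N_ℝ = ℝⁿ`, and the character lattice is
`M = ℤⁿ`, paired with `N_ℝ` by `⟨m, v⟩ = ∑ i, m i * v i`. -/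

namespace Toric

variable {n : ℕ}

/-- The pairing `⟨m, v⟩` of a character with a vector of `N_ℝ`. -/
def pairing (m : Fin n → ℤ) (v : Fin n → ℝ) : ℝ := ∑ i, (m i : ℝ) * v i

theorem pairing_zero (v : Fin n → ℝ) : pairing 0 v = 0 := by simp [pairing]

theorem pairing_add (m m' : Fin n → ℤ) (v : Fin n → ℝ) :
    pairing (m + m') v = pairing m v + pairing m' v := by
  simp [pairing, add_mul, Finset.sum_add_distrib]

theorem pairing_nsmul (k : ℕ) (m : Fin n → ℤ) (v : Fin n → ℝ) :
    pairing (k • m) v = k * pairing m v := by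
  simp [pairing, Finset.mul_sum, mul_assoc]

/-- The monoid `S_σ = σ^∨ ∩ M`. -/
def dualMonoid (σ : PointedCone ℝ (Fin n → ℝ)) : AddSubmonoid (Fin n → ℤ) where
  carrier := {m | ∀ v ∈ σ, 0 ≤ pairing m v}
  zero_mem' v _ := (pairing_zero v).ge
  add_mem' ha hb v hv := by rw [pairing_add]; exact add_nonneg (ha v hv) (hb v hv)

theorem dualMonoid_anti {τ σ : PointedCone ℝ (Fin n → ℝ)} (h : τ ≤ σ) :
    dualMonoid σ ≤ dualMonoid τ :=
  fun _ hm v hv => hm v (h hv)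

/-- Rational polyhedral cones: those generated by finitely many lattice points. -/
def IsRationalPolyhedral (σ : PointedCone ℝ (Fin n → ℝ)) : Prop :=
  ∃ s : Finset (Fin n → ℤ), σ = PointedCone.hull ℝ ((fun u i => (u i : ℝ)) '' (s : Set (Fin n → ℤ)))

/-- The faces of a rational polyhedral cone `σ` are the cones `σ ∩ m^⊥` with `m ∈ σ^∨ ∩ M`. -/
def IsFace (τ σ : PointedCone ℝ (Fin n → ℝ)) : Prop :=
  ∃ m ∈ dualMonoid σ, ∀ v, v ∈ τ ↔ v ∈ σ ∧ pairing m v = 0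

/-- A fan in `N_ℝ`: a finite nonempty collection of strongly convex rational polyhedral cones which
contains all faces of its members, and any two members of which meet in a common face. -/
structure Fan (n : ℕ) where
  cones : Set (PointedCone ℝ (Fin n → ℝ))
  finite : cones.Finite
  nonempty : cones.Nonempty
  isRationalPolyhedral : ∀ σ ∈ cones, IsRationalPolyhedral σ
  salient : ∀ σ ∈ cones, (σ : ConvexCone ℝ (Fin n → ℝ)).Salient
  face_mem : ∀ σ ∈ cones, ∀ τ, IsFace τ σ → τ ∈ cones
  isFace_inf : ∀ σ ∈ cones, ∀ τ ∈ cones, IsFace (σ ⊓ τ) σ ∧ IsFace (σ ⊓ τ) τ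

/-- The affine coordinate ring `ℂ[S_σ]` of the chart `U_σ`. -/
abbrev chartRing (σ : PointedCone ℝ (Fin n → ℝ)) : Type := AddMonoidAlgebra ℂ (dualMonoid σ)

/-- The inclusion `ℂ[S_σ] → ℂ[S_τ]` for `τ ⊆ σ`. -/
def chartRingMap {τ σ : PointedCone ℝ (Fin n → ℝ)} (h : τ ≤ σ) : chartRing σ →+* chartRing τ :=
  AddMonoidAlgebra.mapDomainRingHom ℂ (AddSubmonoid.inclusion (dualMonoid_anti h))

theorem chartRingMap_single {τ σ : PointedCone ℝ (Fin n → ℝ)} (h : τ ≤ σ) (m : dualMonoid σ)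
    (a : ℂ) : chartRingMap h (AddMonoidAlgebra.single m a) =
      AddMonoidAlgebra.single (AddSubmonoid.inclusion (dualMonoid_anti h) m) a := by
  simp [chartRingMap]

theorem chartRingMap_id (σ : PointedCone ℝ (Fin n → ℝ)) :
    chartRingMap (le_refl σ) = RingHom.id (chartRing σ) :=
  AddMonoidAlgebra.mapDomainRingHom_id

theorem chartRingMap_comp {ρ τ σ : PointedCone ℝ (Fin n → ℝ)} (h : ρ ≤ τ) (h' : τ ≤ σ) :
    (chartRingMap h).comp (chartRingMap h') = chartRingMap (h.trans h') :=
  (AddMonoidAlgebra.mapDomainRingHom_comp _ _).symm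

theorem exists_nsmul_add_mem {τ σ : PointedCone ℝ (Fin n → ℝ)} (hσ : IsRationalPolyhedral σ)
    {m : Fin n → ℤ} (hm : m ∈ dualMonoid σ) (hτ : ∀ v, v ∈ τ ↔ v ∈ σ ∧ pairing m v = 0)
    {m' : Fin n → ℤ} (hm' : m' ∈ dualMonoid τ) : ∃ k : ℕ, k • m + m' ∈ dualMonoid σ := by
  obtain ⟨s, hs⟩ := hσ
  have hmem : ∀ u ∈ s, (fun i => (u i : ℝ)) ∈ σ := fun u hu =>
    hs ▸ Submodule.subset_span ⟨u, hu, rfl⟩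
  have hcast : ∀ (a u : Fin n → ℤ), pairing a (fun i => (u i : ℝ)) = ((∑ i, a i * u i : ℤ) : ℝ) :=
    fun a u => by simp [pairing]
  refine ⟨∑ u ∈ s, (∑ i, m' i * u i).natAbs, fun v hv => ?_⟩
  set k : ℕ := ∑ u ∈ s, (∑ i, m' i * u i).natAbs with hk
  rw [hs] at hv
  induction hv using Submodule.span_induction with
  | mem v hv =>
    obtain ⟨u, hu, rfl⟩ := hv
    have h0 := hm _ (hmem u hu)
    rw [pairing_add, pairing_nsmul]
    by_cases hz : pairing m (fun i => (u i : ℝ)) = 0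
    · have := hm' _ ((hτ _).2 ⟨hmem u hu, hz⟩)
      simpa [hz] using this
    · have hle : (∑ i, m' i * u i).natAbs ≤ k :=
        Finset.single_le_sum (f := fun u : Fin n → ℤ => (∑ i, m' i * u i).natAbs)
          (fun _ _ => Nat.zero_le _) hu
      rw [hcast] at h0 hz ⊢
      rw [hcast]
      norm_cast at h0 hz ⊢
      have h1 : 1 ≤ ∑ i, m i * u i := by lia
      have h2 : (k : ℤ) * 1 ≤ k * ∑ i, m i * u i := by gcongr
      lia
  | zero => simp [pairing]
  | add v w _ _ hv hw =>
    have : pairing (k • m + m') (v + w) = pairing (k • m + m') v + pairing (k • m + m') w := by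
      simp [pairing, mul_add, Finset.sum_add_distrib]
    rw [this]
    exact add_nonneg hv hw
  | smul a v _ hv =>
    have : pairing (k • m + m') (a • v) = a * pairing (k • m + m') v := by
      simp only [pairing, Finset.mul_sum]
      exact Finset.sum_congr rfl fun i _ => by
        change _ * ((a : ℝ) * v i) = _
        ring
    rw [this]
    exact mul_nonneg a.2 hv

theorem isLocalization_chartRingMap {τ σ : PointedCone ℝ (Fin n → ℝ)}
    (hσ : IsRationalPolyhedral σ) (h : τ ≤ σ) {m : Fin n → ℤ} (hm : m ∈ dualMonoid σ)
    (hτ : ∀ v, v ∈ τ ↔ v ∈ σ ∧ pairing m v = 0) :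
    letI := (chartRingMap h).toAlgebra
    IsLocalization.Away (AddMonoidAlgebra.single (⟨m, hm⟩ : dualMonoid σ) (1 : ℂ))
      (chartRing τ) := by
  let := (chartRingMap h).toAlgebra
  have halg : ∀ x, algebraMap (chartRing σ) (chartRing τ) x = chartRingMap h x := fun _ => rfl
  have hm0 : ∀ v ∈ τ, pairing m v = 0 := fun v hv => ((hτ v).1 hv).2
  have hneg : -m ∈ dualMonoid τ := fun v hv => by
    have := hm0 v hv
    simp only [pairing, Pi.neg_apply, Int.cast_neg, neg_mul, Finset.sum_neg_distrib] at this ⊢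
    simp [this]
  have hinj : Function.Injective (chartRingMap h) :=
    AddMonoidAlgebra.mapDomain_injective (AddSubmonoid.inclusion_injective _)
  refine IsLocalization.Away.mk _ ?_ ?_ ?_
  · rw [halg, chartRingMap_single]
    refine IsUnit.of_mul_eq_one (AddMonoidAlgebra.single ⟨-m, hneg⟩ 1) ?_
    rw [AddMonoidAlgebra.single_mul_single, AddMonoidAlgebra.one_def]
    congr 1
    · ext; simp
    · simp
  · intro z
    simp only [halg]
    induction z using AddMonoidAlgebra.induction_linear with
    | zero => exact ⟨0, 0, by simp⟩
    | add z w hz hw =>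
      obtain ⟨k, a, ha⟩ := hz
      obtain ⟨l, b, hb⟩ := hw
      refine ⟨k + l, a * (AddMonoidAlgebra.single ⟨m, hm⟩ 1) ^ l +
        b * (AddMonoidAlgebra.single ⟨m, hm⟩ 1) ^ k, ?_⟩
      rw [map_add, map_mul, map_mul, map_pow, map_pow, ← ha, ← hb]
      ring
    | single m' a =>
      obtain ⟨k, hk⟩ := exists_nsmul_add_mem hσ hm hτ m'.2
      refine ⟨k, AddMonoidAlgebra.single ⟨_, hk⟩ a, ?_⟩
      rw [chartRingMap_single, chartRingMap_single, AddMonoidAlgebra.single_pow,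
        AddMonoidAlgebra.single_mul_single]
      congr 1
      · ext; simp [add_comm]
      · simp
  · intro a b hab
    exact ⟨0, by simpa using hinj hab⟩

namespace Fan

variable (F : Fan n)

/-- The cones of the fan, ordered by inclusion; `τ ≤ σ` means that `τ` is a face of `σ`. -/
abbrev Cone : Type := {σ : PointedCone ℝ (Fin n → ℝ) // σ ∈ F.cones}

/-- The diagram of the affine charts `U_σ = Spec ℂ[S_σ]` and the inclusions `U_τ ⟶ U_σ` for the faces
`τ` of `σ`. -/
def charts : F.Cone ⥤ Scheme.{0} where
  obj σ := Spec (.of (chartRing σ.1))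
  map h := Spec.map (CommRingCat.ofHom (chartRingMap h.le))
  map_id σ := by
    rw [chartRingMap_id]
    exact Spec.map_id _
  map_comp f g := by
    rw [← Spec.map_comp, ← CommRingCat.ofHom_comp, chartRingMap_comp]

theorem isFace_of_le {τ σ : F.Cone} (h : τ ≤ σ) : IsFace τ.1 σ.1 := by
  have := (F.isFace_inf τ.1 τ.2 σ.1 σ.2).2
  rwa [inf_eq_left.2 h] at this

instance {τ σ : F.Cone} (f : τ ⟶ σ) : IsOpenImmersion (F.charts.map f) := by
  obtain ⟨m, hm, hτ⟩ := F.isFace_of_le f.le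
  let := (chartRingMap f.le).toAlgebra
  have := isLocalization_chartRingMap (F.isRationalPolyhedral _ σ.2) f.le hm hτ
  exact IsOpenImmersion.of_isLocalization
    (AddMonoidAlgebra.single (⟨m, hm⟩ : dualMonoid σ.1) (1 : ℂ))

theorem range_charts_map {τ σ : F.Cone} (f : τ ⟶ σ) {m : Fin n → ℤ} (hm : m ∈ dualMonoid σ.1)
    (hτ : ∀ v, v ∈ τ.1 ↔ v ∈ σ.1 ∧ pairing m v = 0) :
    Set.range (F.charts.map f) = (PrimeSpectrum.basicOpen
      (AddMonoidAlgebra.single (⟨m, hm⟩ : dualMonoid σ.1) (1 : ℂ)) :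
        Set (PrimeSpectrum (chartRing σ.1))) := by
  let := (chartRingMap f.le).toAlgebra
  have := isLocalization_chartRingMap (F.isRationalPolyhedral _ σ.2) f.le hm hτ
  exact PrimeSpectrum.localization_away_comap_range (chartRing τ.1)
    (AddMonoidAlgebra.single (⟨m, hm⟩ : dualMonoid σ.1) (1 : ℂ))

instance : (F.charts ⋙ Scheme.forget).IsLocallyDirected where
  cond {i j k} fi fj xi xj h := by
    change F.charts.map fi xi = F.charts.map fj xj at h
    obtain ⟨a, ha, hai⟩ := F.isFace_of_le fi.le
    obtain ⟨b, hb, hbj⟩ := F.isFace_of_le fj.le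
    let l : F.Cone := ⟨i.1 ⊓ j.1,
      F.face_mem _ i.2 _ (F.isFace_inf _ i.2 _ j.2).1⟩
    let li : l ⟶ i := homOfLE (inf_le_left : i.1 ⊓ j.1 ≤ i.1)
    let lj : l ⟶ j := homOfLE (inf_le_right : i.1 ⊓ j.1 ≤ j.1)
    have hl : ∀ v, v ∈ l.1 ↔ v ∈ k.1 ∧ pairing (a + b) v = 0 := by
      intro v
      rw [pairing_add]
      constructor
      · rintro ⟨h1, h2⟩
        have h1 := (hai v).1 h1
        have h2 := (hbj v).1 h2
        exact ⟨h1.1, by rw [h1.2, h2.2, add_zero]⟩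
      · rintro ⟨hv, h0⟩
        have h1 := ha v hv
        have h2 := hb v hv
        exact ⟨(hai v).2 ⟨hv, by linarith⟩, (hbj v).2 ⟨hv, by linarith⟩⟩
    have hi : F.charts.map fi xi ∈ Set.range (F.charts.map fi) := ⟨xi, rfl⟩
    have hj : F.charts.map fi xi ∈ Set.range (F.charts.map fj) := ⟨xj, h.symm⟩
    rw [F.range_charts_map fi ha hai] at hi
    rw [F.range_charts_map fj hb hbj] at hj
    have hx : F.charts.map fi xi ∈ Set.range (F.charts.map (li ≫ fi)) := by
      rw [F.range_charts_map (li ≫ fi) (add_mem ha hb) hl]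
      have e : AddMonoidAlgebra.single (⟨a + b, add_mem ha hb⟩ : dualMonoid k.1) (1 : ℂ) =
          AddMonoidAlgebra.single ⟨a, ha⟩ 1 * AddMonoidAlgebra.single ⟨b, hb⟩ 1 := by
        rw [AddMonoidAlgebra.single_mul_single, one_mul]
        rfl
      rw [e, PrimeSpectrum.basicOpen_mul]
      exact ⟨hi, hj⟩
    obtain ⟨x, hx⟩ := hx
    refine ⟨l, li, lj, x, ?_, ?_⟩
    · apply (F.charts.map fi).isOpenEmbedding.injective
      rw [F.charts.map_comp] at hx
      exact hx
    · apply (F.charts.map fj).isOpenEmbedding.injective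
      have e : li ≫ fi = lj ≫ fj := Subsingleton.elim _ _
      rw [e, F.charts.map_comp, h] at hx
      exact hx

/-- The toric variety `X_Σ`: the charts `U_σ` glued along `U_σ ∩ U_τ = U_{σ ∩ τ}`. -/
def toricVariety : Scheme.{0} := colimit F.charts

/-- The fan is simplicial if each of its cones is generated by linearly independent vectors. -/
def IsSimplicial : Prop := ∀ σ ∈ F.cones, σ.IsSimplicial

end Fan

/-- The value `χ^m(t) = ∏ i, (t i) ^ (m i)` of the character `m` at the point `t` of the torus
`T = (ℂˣ)ⁿ`. -/
def character (t : Fin n → ℂˣ) (m : Fin n → ℤ) : ℂˣ := ∏ i, t i ^ m i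

theorem character_zero (t : Fin n → ℂˣ) : character t 0 = 1 := by simp [character]

theorem character_add (t : Fin n → ℂˣ) (m m' : Fin n → ℤ) :
    character t (m + m') = character t m * character t m' := by
  simp [character, zpow_add, Finset.prod_mul_distrib]

/-- The comorphism `χ^m ↦ χ^m(t) χ^m` of the action of `t` on `U_σ`. -/
def chartActionRingHom (t : Fin n → ℂˣ) (σ : PointedCone ℝ (Fin n → ℝ)) :
    chartRing σ →ₐ[ℂ] chartRing σ :=
  AddMonoidAlgebra.lift ℂ (chartRing σ) (dualMonoid σ)
    { toFun := fun m => AddMonoidAlgebra.single m.toAdd (character t m.toAdd : ℂ)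
      map_one' := by
        change AddMonoidAlgebra.single 0 (character t 0 : ℂ) = _
        rw [character_zero]
        rfl
      map_mul' := fun m m' => by
        change AddMonoidAlgebra.single (m.toAdd + m'.toAdd)
          (character t (m.toAdd + m'.toAdd) : ℂ) = _
        rw [character_add, AddMonoidAlgebra.single_mul_single, Units.val_mul] }

theorem chartActionRingHom_single (t : Fin n → ℂˣ) (σ : PointedCone ℝ (Fin n → ℝ))
    (m : dualMonoid σ) (a : ℂ) :
    chartActionRingHom t σ (AddMonoidAlgebra.single m a) =
      AddMonoidAlgebra.single m (a * character t m) := by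
  simp [chartActionRingHom, AddMonoidAlgebra.lift_single]

theorem chartActionRingHom_comp (t : Fin n → ℂˣ) {τ σ : PointedCone ℝ (Fin n → ℝ)} (h : τ ≤ σ) :
    (chartActionRingHom t τ).toRingHom.comp (chartRingMap h) =
      (chartRingMap h).comp (chartActionRingHom t σ).toRingHom := by
  refine RingHom.ext fun x => ?_
  induction x using AddMonoidAlgebra.induction_linear with
  | zero => simp
  | add x y hx hy => rw [map_add, map_add, hx, hy]
  | single m a =>
    change chartActionRingHom t τ (chartRingMap h _) = chartRingMap h (chartActionRingHom t σ _)
    rw [chartRingMap_single, chartActionRingHom_single, chartActionRingHom_single,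
      chartRingMap_single]
    rfl

namespace Fan

variable (F : Fan n)

/-- The action of `t ∈ T` on the diagram of charts. -/
def chartsAction (t : Fin n → ℂˣ) : F.charts ⟶ F.charts where
  app σ := Spec.map (CommRingCat.ofHom (chartActionRingHom t σ.1).toRingHom)
  naturality τ σ f := by
    change Spec.map _ ≫ Spec.map _ = Spec.map _ ≫ Spec.map _
    rw [← Spec.map_comp, ← Spec.map_comp, ← CommRingCat.ofHom_comp, ← CommRingCat.ofHom_comp,
      chartActionRingHom_comp]

/-- The action of `t ∈ T` on the toric variety. -/
def torusAction (t : Fin n → ℂˣ) : F.toricVariety ⟶ F.toricVariety := colimMap (F.chartsAction t)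

/-- `Z` is torus-invariant: `t · Z ⊆ Z` for all `t ∈ T`. -/
def IsTorusInvariant (Z : Set F.toricVariety) : Prop :=
  ∀ t : Fin n → ℂˣ, F.torusAction t '' Z ⊆ Z

end Fan

end Toric

/-- A closed irreducible subset `D` of `X` is a prime divisor if it has codimension one. -/
def IsPrimeDivisor {X : Scheme.{0}} (D : IrreducibleCloseds X) : Prop := Order.coheight D = 1

/-- The ideal sheaf of `D` with its reduced closed subscheme structure. -/
def reducedIdeal {X : Scheme.{0}} (D : IrreducibleCloseds X) : X.IdealSheafData :=
  Scheme.IdealSheafData.vanishingIdeal ⟨D, D.isClosed⟩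

/-! ## Mayer–Vietoris sequence of closed subschemes -/

namespace MayerVietoris

variable {X : Scheme.{0}}

/-- `𝒪_Z` as an `𝒪_X`-module, where `Z` is the closed subscheme of `X` with ideal sheaf `I`:
the pushforward to `X` of the structure sheaf of `Z`. -/
def structureModule (I : X.IdealSheafData) : X.Modules :=
  (Scheme.Modules.pushforward I.subschemeι).obj (SheafOfModules.unit I.subscheme.ringCatSheaf)

/-- For closed subschemes `W ⊆ Z` with ideal sheaves `I ≤ J`, the restriction of functions
`𝒪_Z ⟶ 𝒪_W`, obtained from the comorphism `𝒪_Z ⟶ i_* 𝒪_W` of the inclusion `i : W ⟶ Z`. -/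
def restrictionMap {I J : X.IdealSheafData} (h : I ≤ J) :
    structureModule I ⟶ structureModule J :=
  (Scheme.Modules.pushforward I.subschemeι).map
      (SheafOfModules.unitToPushforwardObjUnit
        (Scheme.IdealSheafData.inclusion h).toRingCatSheafHom) ≫
    (Scheme.Modules.pushforwardComp (Scheme.IdealSheafData.inclusion h) I.subschemeι).hom.app
      (SheafOfModules.unit J.subscheme.ringCatSheaf) ≫
    (Scheme.Modules.pushforwardCongr (Scheme.IdealSheafData.inclusion_subschemeι h)).hom.app
      (SheafOfModules.unit J.subscheme.ringCatSheaf)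

theorem preimage_le_preimage {I J : X.IdealSheafData} (h : I ≤ J) (U : X.Opens) :
    J.subschemeι ⁻¹ᵁ U ≤ Scheme.IdealSheafData.inclusion h ⁻¹ᵁ I.subschemeι ⁻¹ᵁ U := by
  rw [← Scheme.Hom.comp_preimage, Scheme.IdealSheafData.inclusion_subschemeι]

/-- On sections, `restrictionMap` is the comorphism of the inclusion of closed subschemes. -/
theorem restrictionMap_app {I J : X.IdealSheafData} (h : I ≤ J) (U : X.Opens)
    (s : Γ(I.subscheme, I.subschemeι ⁻¹ᵁ U)) :
    (restrictionMap h).app U s =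
      (Scheme.IdealSheafData.inclusion h).appLE (I.subschemeι ⁻¹ᵁ U) (J.subschemeι ⁻¹ᵁ U)
        (preimage_le_preimage h U) s :=
  rfl

theorem restrictionMap_comp {I J K : X.IdealSheafData} (h : I ≤ J) (h' : J ≤ K) :
    restrictionMap h ≫ restrictionMap h' = restrictionMap (h.trans h') := by
  ext U s
  have e : (Scheme.IdealSheafData.inclusion h).appLE (I.subschemeι ⁻¹ᵁ U) (J.subschemeι ⁻¹ᵁ U)
        (preimage_le_preimage h U) ≫
      (Scheme.IdealSheafData.inclusion h').appLE (J.subschemeι ⁻¹ᵁ U) (K.subschemeι ⁻¹ᵁ U)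
        (preimage_le_preimage h' U) =
      (Scheme.IdealSheafData.inclusion (h.trans h')).appLE (I.subschemeι ⁻¹ᵁ U)
        (K.subschemeι ⁻¹ᵁ U) (preimage_le_preimage (h.trans h') U) := by
    simp [Scheme.Hom.appLE_comp_appLE]
  exact congr($e s)

/-- The scheme-theoretic intersection `D_{i₀} ∩ … ∩ D_{iₚ}`: its ideal sheaf is the sum of the ideal
sheaves of the `D_i`. An index tuple `i₀ < … < iₚ` is an order embedding `Fin (p + 1) ↪o Fin r`. -/
def interIdeal {r : ℕ} (I : Fin r → X.IdealSheafData) {p : ℕ} (c : Fin (p + 1) ↪o Fin r) :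
    X.IdealSheafData :=
  ⨆ j, I (c j)

/-- The scheme-theoretic union `D_1 ∪ … ∪ D_r`: its ideal sheaf is the intersection of the ideal
sheaves of the `D_i`. -/
def unionIdeal {r : ℕ} (I : Fin r → X.IdealSheafData) : X.IdealSheafData :=
  ⨅ i, I i

/-- The tuple `i₀ < … < î_j < … < i_{p+1}`. -/
def dropIndex {r p : ℕ} (c : Fin (p + 2) ↪o Fin r) (j : Fin (p + 2)) : Fin (p + 1) ↪o Fin r :=
  (Fin.succAboveOrderEmb j).trans c

theorem interIdeal_dropIndex_le {r : ℕ} (I : Fin r → X.IdealSheafData) {p : ℕ}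
    (c : Fin (p + 2) ↪o Fin r) (j : Fin (p + 2)) :
    interIdeal I (dropIndex c j) ≤ interIdeal I c :=
  iSup_le fun k => le_iSup (fun j => I (c j)) (j.succAbove k)

theorem unionIdeal_le {r : ℕ} (I : Fin r → X.IdealSheafData) (c : Fin 1 ↪o Fin r) :
    unionIdeal I ≤ interIdeal I c :=
  (iInf_le I (c 0)).trans (le_iSup (fun j => I (c j)) 0)

instance (a b : ℕ) : Finite (Fin a ↪o Fin b) :=
  Finite.of_injective (fun c => (c : Fin a → Fin b)) DFunLike.coe_injective

instance : HasFiniteBiproducts X.Modules := Abelian.hasFiniteBiproducts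

/-- `⨁_{i₀ < … < iₚ} 𝒪_{D_{i₀} ∩ … ∩ D_{iₚ}}`. -/
abbrev term {r : ℕ} (I : Fin r → X.IdealSheafData) (p : ℕ) : X.Modules :=
  ⨁ fun c : Fin (p + 1) ↪o Fin r => structureModule (interIdeal I c)

/-- `(d φ)_{i₀ … i_{p+1}} = ∑ⱼ (-1)ʲ φ_{i₀ … î_j … i_{p+1}}`, where the `j`-th summand is restricted
to `D_{i₀} ∩ … ∩ D_{i_{p+1}}`. -/
def differential {r : ℕ} (I : Fin r → X.IdealSheafData) (p : ℕ) : term I p ⟶ term I (p + 1) :=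
  biproduct.lift fun c => ∑ j : Fin (p + 2), (-1 : ℤ) ^ (j : ℕ) •
    (biproduct.π (fun c : Fin (p + 1) ↪o Fin r => structureModule (interIdeal I c)) (dropIndex c j) ≫
      restrictionMap (interIdeal_dropIndex_le I c j))

/-- The restriction map `𝒪_D ⟶ ⨁ᵢ 𝒪_{Dᵢ}`, where `D = D_1 ∪ … ∪ D_r`. -/
def augmentation {r : ℕ} (I : Fin r → X.IdealSheafData) :
    structureModule (unionIdeal I) ⟶ term I 0 :=
  biproduct.lift fun c => restrictionMap (unionIdeal_le I c)

theorem lift_comp_differential {r : ℕ} (I : Fin r → X.IdealSheafData) (p : ℕ) {M : X.Modules}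
    (φ : ∀ c : Fin (p + 1) ↪o Fin r, M ⟶ structureModule (interIdeal I c))
    (c : Fin (p + 2) ↪o Fin r) :
    (biproduct.lift φ : M ⟶ term I p) ≫ differential I p ≫ biproduct.π _ c =
      ∑ j : Fin (p + 2), (-1 : ℤ) ^ (j : ℕ) •
        (φ (dropIndex c j) ≫ restrictionMap (interIdeal_dropIndex_le I c j)) := by
  simp [differential, Preadditive.comp_sum]

theorem differential_comp {r : ℕ} (I : Fin r → X.IdealSheafData) (p : ℕ) :
    differential I p ≫ differential I (p + 1) = 0 := by
  apply biproduct.hom_ext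
  intro c
  rw [Category.assoc, zero_comp]
  conv_lhs => rw [differential]
  rw [lift_comp_differential]
  simp only [Preadditive.sum_comp, Preadditive.zsmul_comp, Finset.smul_sum, smul_smul,
    Category.assoc, restrictionMap_comp]
  rw [← Finset.sum_product', Finset.univ_product_univ]
  have key : ∀ (a b : Fin (p + 1) ↪o Fin r) (ha : interIdeal I a ≤ interIdeal I c)
      (hb : interIdeal I b ≤ interIdeal I c), a = b →
      biproduct.π (fun c : Fin (p + 1) ↪o Fin r => structureModule (interIdeal I c)) a ≫
        restrictionMap ha =
      biproduct.π (fun c : Fin (p + 1) ↪o Fin r => structureModule (interIdeal I c)) b ≫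
        restrictionMap hb := by
    rintro a _ ha hb rfl
    rfl
  let S : Finset (Fin (p + 3) × Fin (p + 2)) := {ij | (ij.1 : ℕ) ≤ (ij.2 : ℕ)}
  rw [← Finset.sum_add_sum_compl S, ← eq_neg_iff_add_eq_zero, ← Finset.sum_neg_distrib]
  refine Finset.sum_bij (fun ij hij => (ij.2.succ, Fin.castLT ij.1
    (lt_of_le_of_lt (Finset.mem_filter.mp hij).right (Fin.is_lt ij.2)))) ?_ ?_ ?_ ?_
  · intro ij hij
    simp_rw [S, Finset.compl_filter, Finset.mem_filter_univ, Fin.val_succ,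
      Fin.val_castLT] at hij ⊢
    lia
  · rintro ⟨i, j⟩ hij ⟨i', j'⟩ hij' h
    simp only [Prod.mk.injEq, Fin.ext_iff, Fin.val_succ, Fin.val_castLT] at h ⊢
    lia
  · rintro ⟨i', j'⟩ hij'
    simp_rw [S, Finset.compl_filter, Finset.mem_filter_univ, not_le] at hij'
    refine ⟨(Fin.castSucc j', i'.pred ?_), ?_, ?_⟩
    · rintro rfl
      simp at hij'
    · simpa [S] using Nat.le_sub_one_of_lt hij'
    · simp
  · rintro ⟨i, j⟩ hij
    rw [← neg_smul]
    congr 1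
    · simp only [Fin.val_succ, Fin.val_castLT]
      ring
    · apply key
      ext k
      simp only [S, Finset.mem_filter_univ] at hij
      simp only [dropIndex, RelEmbedding.coe_trans, Function.comp_apply,
        Fin.succAboveOrderEmb_apply]
      congr 2
      ext
      simp only [Fin.succAbove, Fin.lt_def]
      split_ifs <;> simp at * <;> lia

theorem augmentation_comp {r : ℕ} (I : Fin r → X.IdealSheafData) :
    augmentation I ≫ differential I 0 = 0 := by
  apply biproduct.hom_ext
  intro c
  rw [Category.assoc, zero_comp, augmentation, lift_comp_differential]
  simp [restrictionMap_comp, Fin.sum_univ_two]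

/-- The Mayer–Vietoris sheaf sequence
`0 ⟶ 𝒪_D ⟶ ⨁ᵢ 𝒪_{Dᵢ} ⟶ ⨁_{i<j} 𝒪_{Dᵢ ∩ Dⱼ} ⟶ … ⟶ 𝒪_{D_1 ∩ … ∩ D_r} ⟶ 0`
of the closed subschemes `D_i` of `X` with ideal sheaves `I i`, as a cochain complex of
`𝒪_X`-modules with `𝒪_D` in degree `0`. -/
def sheafSequence {r : ℕ} (I : Fin r → X.IdealSheafData) : CochainComplex X.Modules ℕ :=
  (CochainComplex.of (term I) (differential I) (differential_comp I)).augment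
    (augmentation I) ((congrArg (augmentation I ≫ ·)
      (CochainComplex.of_d (term I) (differential I) 0)).trans (augmentation_comp I))

end MayerVietoris

end

noncomputable section

/-! ## Families of ideals with exact Mayer–Vietoris sequence -/

/-! Exactness of a complex of sheaves is local, so it suffices to lift kernel sections on small
affine opens `V`. There each structure sheaf has sections `A/I`, with `A = Γ(X, V)`, and the problem
becomes one about ideals `I₁, …, I_r` of `A`, recorded by `IsExactFamily`. The kernel of `A ⟶ ⨁
A/Iᵢ` is `⨅ Iᵢ`, the ideal of the union, so injectivity at `𝒪_D` needs no further argument.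

On a chart `U_σ` the ideal of a torus-invariant closed set is stable under the torus. Distinct
characters of the torus are linearly independent, so such an ideal contains every monomial occurring
in its elements (`isMonomialIdeal_of_chartActionRingHom_mem`).

For monomial ideals the sequence is graded by `S_σ`. In degree `m` the quotient `A/(I_{i₀} + … +
I_{iₚ})` is `K` if all `i_k` lie in `J(m) = {i | χ^m ∉ Iᵢ}`, and zero otherwise. Hence the degree
`m` part is the augmented cochain complex of the full simplex on `J(m)`. A nonempty simplex is
contractible by coning from its least vertex (`coboundary_contraction`), and for empty `J(m)` all
terms after `A` vanish in degree `m`. This gives `isExactFamily_of_isMonomialIdeal`, and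
localization carries it to the basic opens of the charts. -/

namespace MayerVietoris

/-! ### Alternating sums over increasing tuples, and the cone homotopy. -/

section Coboundary

variable {r : ℕ} {M N : Type*} [AddCommGroup M] [AddCommGroup N]

/-- The tuple `i₀ < … < î_j < … < iₚ`, which is empty for `p = 0`. -/
def face {p : ℕ} (c : Fin (p + 1) ↪o Fin r) (j : Fin (p + 1)) : Fin p ↪o Fin r :=
  (Fin.succAboveOrderEmb j).trans c

theorem face_apply {p : ℕ} (c : Fin (p + 1) ↪o Fin r) (j : Fin (p + 1)) (k : Fin p) :
    face c j k = c (j.succAbove k) := rfl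

/-- The alternating sum `∑ⱼ (-1)ʲ φ_{i₀ … î_j … iₚ}`. -/
def coboundary {p : ℕ} (φ : (Fin p ↪o Fin r) → M) (c : Fin (p + 1) ↪o Fin r) : M :=
  ∑ j : Fin (p + 1), (-1 : ℤ) ^ (j : ℕ) • φ (face c j)

theorem map_coboundary (f : M →+ N) {p : ℕ} (φ : (Fin p ↪o Fin r) → M)
    (c : Fin (p + 1) ↪o Fin r) : f (coboundary φ c) = coboundary (fun b => f (φ b)) c := by
  simp [coboundary]

/-- The tuple `i < i₀ < … < iₚ`. -/
def consEmb {p : ℕ} (i : Fin r) (c : Fin p ↪o Fin r) (h : ∀ k, i < c k) :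
    Fin (p + 1) ↪o Fin r :=
  OrderEmbedding.ofStrictMono (Fin.cons i c) (by
    rw [Fin.strictMono_cons]
    exact ⟨h, c.strictMono⟩)

theorem consEmb_zero {p : ℕ} (i : Fin r) (c : Fin p ↪o Fin r) (h : ∀ k, i < c k) :
    consEmb i c h 0 = i := rfl

theorem consEmb_succ {p : ℕ} (i : Fin r) (c : Fin p ↪o Fin r) (h : ∀ k, i < c k) (k : Fin p) :
    consEmb i c h k.succ = c k := rfl

theorem face_consEmb_zero {p : ℕ} (i : Fin r) (c : Fin p ↪o Fin r) (h : ∀ k, i < c k) :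
    face (consEmb i c h) 0 = c := by
  ext k
  simp [face_apply, consEmb_succ]

theorem lt_face_apply {p : ℕ} {i : Fin r} {c : Fin (p + 1) ↪o Fin r} (h : ∀ k, i < c k)
    (j : Fin (p + 1)) (k : Fin p) : i < face c j k := h _

theorem face_consEmb_succ {p : ℕ} (i : Fin r) (c : Fin (p + 1) ↪o Fin r) (h : ∀ k, i < c k)
    (j : Fin (p + 1)) :
    face (consEmb i c h) j.succ = consEmb i (face c j) (lt_face_apply h j) := by
  ext k
  refine Fin.cases ?_ (fun k => ?_) k
  · rw [face_apply, Fin.succ_succAbove_zero, consEmb_zero, consEmb_zero]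
  · rw [face_apply, Fin.succ_succAbove_succ, consEmb_succ, consEmb_succ, face_apply]

theorem consEmb_face_zero {p : ℕ} (c : Fin (p + 1) ↪o Fin r) (h : ∀ k, c 0 < face c 0 k) :
    consEmb (c 0) (face c 0) h = c := by
  ext k
  refine Fin.cases ?_ (fun k => ?_) k
  · simp [consEmb_zero]
  · simp [face_apply, consEmb_succ]

open Classical in
/-- The contraction `c ↦ φ_{i, c}`. -/
def contraction {p : ℕ} (i : Fin r) (φ : (Fin (p + 1) ↪o Fin r) → M) (c : Fin p ↪o Fin r) : M :=
  if h : ∀ k, i < c k then φ (consEmb i c h) else 0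

/-- On tuples of elements of `J`, contraction with the least element of `J` is a contracting
homotopy. -/
theorem coboundary_contraction {J : Set (Fin r)} {i : Fin r} (hi : IsLeast J i) {p : ℕ}
    (φ : (Fin (p + 1) ↪o Fin r) → M)
    (hφ : ∀ c : Fin (p + 2) ↪o Fin r, (∀ k, c k ∈ J) → coboundary φ c = 0)
    (c : Fin (p + 1) ↪o Fin r) (hc : ∀ k, c k ∈ J) :
    coboundary (contraction i φ) c = φ c := by
  rcases (hi.2 (hc 0)).lt_or_eq with h0 | h0
  -- If `i` is not in `c`, the cocycle condition on `(i, c)` reads `φ c - ∑ⱼ (-1)ʲ φ (i, face c j) =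
  -- 0`.
  · have h : ∀ k, i < c k := fun k => h0.trans_le (c.monotone (Fin.zero_le k))
    have key := hφ (consEmb i c h) (Fin.cases hi.1 hc)
    rw [coboundary, Fin.sum_univ_succ] at key
    simp only [face_consEmb_zero, face_consEmb_succ, Fin.val_zero, pow_zero, one_smul,
      Fin.val_succ, pow_succ, mul_neg, mul_one, neg_smul, Finset.sum_neg_distrib] at key
    rw [← sub_eq_add_neg, sub_eq_zero] at key
    rw [key, coboundary]
    refine Finset.sum_congr rfl fun j _ => ?_
    rw [contraction, dif_pos (lt_face_apply h j)]
  -- If `c` starts with `i`, only the face omitting `i` can be coned from `i`; the other faces still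
  -- begin with `i`, where the contraction takes its default value `0`.
  · subst h0
    rw [coboundary, Fin.sum_univ_succ, Finset.sum_eq_zero, add_zero]
    · have h : ∀ k, c 0 < face c 0 k := fun k => c.strictMono (by simp)
      rw [contraction, dif_pos h, consEmb_face_zero]
      simp
    · intro j _
      obtain _ | p := p
      · exact j.elim0
      · rw [contraction, dif_neg, smul_zero]
        intro h
        have := h 0
        rw [face_apply, Fin.succ_succAbove_zero] at this
        exact this.false

end Coboundary

/-! ### Exactness for a family of ideals, stated on representatives in the ring. -/

section IsExactFamily

variable {r : ℕ} {A : Type*} [CommRing A]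

/-- The sequence `A ⟶ ⨁ᵢ A/Iᵢ ⟶ ⨁_{i<j} A/(Iᵢ + Iⱼ) ⟶ …` is exact from the second term on. -/
def IsExactFamily (I : Fin r → Ideal A) : Prop :=
  ∀ (p : ℕ) (φ : (Fin (p + 1) ↪o Fin r) → A),
    (∀ c : Fin (p + 2) ↪o Fin r, coboundary φ c ∈ ⨆ k, I (c k)) →
    ∃ ψ : (Fin p ↪o Fin r) → A,
      ∀ c : Fin (p + 1) ↪o Fin r, φ c - coboundary ψ c ∈ ⨆ k, I (c k)

/-- There are finitely many tuples, so denominators can be cleared uniformly: lift a cocycle to `A`,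
solve there, and divide back. -/
theorem IsExactFamily.localization {I : Fin r → Ideal A} (hI : IsExactFamily I)
    (S : Submonoid A) (B : Type*) [CommRing B] [Algebra A B] [IsLocalization S B] :
    IsExactFamily fun i => (I i).map (algebraMap A B) := by
  intro p φ hφ
  simp only [← Ideal.map_iSup] at hφ ⊢
  have := Fintype.ofFinite (Fin (p + 2) ↪o Fin r)
  -- `b` is a common denominator of all the `φ c`. The numerators `φ'` satisfy the cocycle condition
  -- only up to elements `m c` of `S`, whose product `s` repairs all conditions at once.
  obtain ⟨b, hb⟩ := IsLocalization.exist_integer_multiples_of_finite S φ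
  choose φ' hφ' using hb
  have h1 (c : Fin (p + 2) ↪o Fin r) : ∃ m ∈ S, m * coboundary φ' c ∈ ⨆ k, I (c k) := by
    rw [← IsLocalization.algebraMap_mem_map_algebraMap_iff S B]
    have e := map_coboundary (algebraMap A B).toAddMonoidHom φ' c
    have e' := map_coboundary (AddMonoidHom.mulLeft (algebraMap A B b)) φ c
    simp only [RingHom.toAddMonoidHom_eq_coe, AddMonoidHom.coe_coe, hφ', Algebra.smul_def] at e
    simp only [AddMonoidHom.coe_mulLeft] at e'
    rw [e]
    erw [← e']
    exact Ideal.mul_mem_left _ _ (hφ c)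
  choose m hm hmφ using h1
  let s := ∏ c, m c
  have hs : s ∈ S := prod_mem fun c _ => hm c
  obtain ⟨ψ', hψ'⟩ := hI p (fun c => s * φ' c) fun c => by
    have e := map_coboundary (AddMonoidHom.mulLeft s) φ' c
    simp only [AddMonoidHom.coe_mulLeft] at e
    rw [← e]
    exact Ideal.mem_of_dvd _ (mul_dvd_mul_right (Finset.dvd_prod_of_mem m (Finset.mem_univ c)) _)
      (hmφ c)
  obtain ⟨u, hu⟩ := IsLocalization.map_units B (⟨s * b, mul_mem hs b.2⟩ : S)
  refine ⟨fun c => ↑u⁻¹ * algebraMap A B (ψ' c), fun c => ?_⟩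
  have e := map_coboundary (AddMonoidHom.mulLeft (↑u⁻¹ : B)) (fun b => algebraMap A B (ψ' b)) c
  have e' := map_coboundary (algebraMap A B).toAddMonoidHom ψ' c
  simp only [AddMonoidHom.coe_mulLeft] at e
  simp only [RingHom.toAddMonoidHom_eq_coe, AddMonoidHom.coe_coe] at e'
  have h2 := Ideal.mul_mem_left _ (↑u⁻¹ : B) (Ideal.mem_map_of_mem (algebraMap A B) (hψ' c))
  convert h2 using 1
  rw [← e, ← e', map_sub, mul_sub, map_mul, hφ', Algebra.smul_def]
  congr 1
  rw [← mul_assoc (algebraMap A B s), ← map_mul, ← mul_assoc]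
  change _ = ↑u⁻¹ * algebraMap A B ↑(⟨s * b, mul_mem hs b.2⟩ : S) * φ c
  rw [← hu, Units.inv_mul, one_mul]

end IsExactFamily

/-! ### Monomial ideals in semigroup algebras. -/

section Monomial

theorem coeff_coboundary {K S : Type*} [CommRing K] {r p : ℕ}
    (φ : (Fin p ↪o Fin r) → AddMonoidAlgebra K S)
    (c : Fin (p + 1) ↪o Fin r) (m : S) :
    (coboundary φ c).coeff m = coboundary (fun b => (φ b).coeff m) c :=
  map_coboundary ((Finsupp.applyAddHom m).comp
    (AddMonoidAlgebra.coeffAddEquiv (R := K) (M := S)).toAddMonoidHom) φ c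

variable {K S : Type*} [CommRing K] [AddCommMonoid S]

/-- An ideal of a semigroup algebra spanned by monomials. -/
def IsMonomialIdeal (I : Ideal (AddMonoidAlgebra K S)) : Prop :=
  ∀ f ∈ I, ∀ m ∈ f.coeff.support, AddMonoidAlgebra.single m 1 ∈ I

/-- Membership in a sum of monomial ideals is decided one monomial at a time, which makes the
sequence split by degree. -/
theorem mem_iSup_iff_of_isMonomialIdeal {ι : Type*} {I : ι → Ideal (AddMonoidAlgebra K S)}
    (hI : ∀ i, IsMonomialIdeal (I i)) (f : AddMonoidAlgebra K S) :
    f ∈ ⨆ i, I i ↔ ∀ m, f.coeff m ≠ 0 → ∃ i, AddMonoidAlgebra.single m 1 ∈ I i := by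
  constructor
  · intro hf
    induction hf using Submodule.iSup_induction' with
    | mem i x hx => exact fun m hm => ⟨i, hI i x hx m (Finsupp.mem_support_iff.2 hm)⟩
    | zero => simp
    | add x y _ _ hx hy =>
      intro m hm
      by_cases h : x.coeff m = 0
      · exact hy m fun h' => hm (by simp [h, h'])
      · exact hx m h
  · intro h
    rw [← AddMonoidAlgebra.sum_coeff_single f]
    refine sum_mem fun m hm => ?_
    obtain ⟨i, hi⟩ := h m (Finsupp.mem_support_iff.1 hm)
    have := Ideal.mul_mem_left _ (AddMonoidAlgebra.single 0 (f.coeff m))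
      (Ideal.mem_iSup_of_mem i hi)
    simpa [AddMonoidAlgebra.single_mul_single] using this

/-- In degree `m` only tuples in `J m` matter, and on these the cone from the least element of `J m`
solves the equation. -/
theorem isExactFamily_of_isMonomialIdeal {r : ℕ} {I : Fin r → Ideal (AddMonoidAlgebra K S)}
    (hI : ∀ i, IsMonomialIdeal (I i)) : IsExactFamily I := by
  classical
  intro p φ hφ
  have := Fintype.ofFinite (Fin (p + 1) ↪o Fin r)
  let J (m : S) : Set (Fin r) := {i | AddMonoidAlgebra.single m 1 ∉ I i}
  have hJ (m : S) (h : (J m).Nonempty) : ∃ i, IsLeast (J m) i :=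
    
    ⟨_, wellFounded_lt.min_mem (J m) h, fun _ hj => wellFounded_lt.min_le hj⟩
  let i (m : S) (h : (J m).Nonempty) : Fin r := (hJ m h).choose
  have hi (m : S) (h : (J m).Nonempty) : IsLeast (J m) (i m h) := (hJ m h).choose_spec
  let g (c : Fin p ↪o Fin r) (m : S) : K :=
    if h : (J m).Nonempty then contraction (i m h) (fun b => (φ b).coeff m) c else 0
  -- The degreewise solutions vanish outside the finitely many degrees occurring in `φ`, so they
  -- assemble to elements of the algebra.
  let T : Finset S := Finset.univ.biUnion fun b => (φ b).coeff.support
  have hT (c : Fin p ↪o Fin r) (m : S) (hm : g c m ≠ 0) : m ∈ T := by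
    simp only [g, contraction] at hm
    split_ifs at hm with h h'
    · exact Finset.mem_biUnion.2 ⟨_, Finset.mem_univ _, Finsupp.mem_support_iff.2 hm⟩
    · exact absurd rfl hm
    · exact absurd rfl hm
  refine ⟨fun c => .ofCoeff (Finsupp.onFinset T (g c) (hT c)), fun c => ?_⟩
  rw [mem_iSup_iff_of_isMonomialIdeal fun _ => hI _]
  intro m hm
  by_contra! hc
  refine hm ?_
  have h : (J m).Nonempty := ⟨c 0, hc 0⟩
  -- For `b` in `J m` no ideal of the sum contains the monomial `m`, so the coboundary of `φ` has
  -- coefficient `0` there: in degree `m` the cocycle condition is an honest equality.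
  have key := coboundary_contraction (hi m h) (fun b => (φ b).coeff m) (fun b hb => by
    rw [← coeff_coboundary]
    by_contra h0
    obtain ⟨k, hk⟩ := (mem_iSup_iff_of_isMonomialIdeal (fun _ => hI _) _).1 (hφ b) m h0
    exact hb k hk) c hc
  rw [AddMonoidAlgebra.coeff_sub, Finsupp.sub_apply, coeff_coboundary, ← key, sub_eq_zero]
  simp [g, h]

end Monomial

end MayerVietoris

/-! ## Exactness of complexes of sheaves of modules -/

namespace AlgebraicGeometry.Scheme.Modules

variable {X : Scheme.{0}}

theorem eq_zero_of_locally_eq_zero (M : X.Modules) {U : X.Opens} (s : Γ(M, U))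
    (h : ∀ x ∈ U, ∃ (V : X.Opens) (i : V ≤ U), x ∈ V ∧ M.presheaf.map (homOfLE i).op s = 0) :
    s = 0 := by
  choose V i hx hV using h
  refine TopCat.Sheaf.eq_of_locally_eq' (⟨M.presheaf, M.isSheaf⟩ : TopCat.Sheaf Ab X)
    (fun x : U => V x x.2) U (fun x => homOfLE (i x x.2))
    (fun x hxU => Opens.mem_iSup.2 ⟨⟨x, hxU⟩, hx x hxU⟩) s 0 fun x => ?_
  rw [map_zero]
  exact hV x x.2

theorem app_map {M N : X.Modules} (f : M ⟶ N) {U V : X.Opens} (i : V ≤ U) (s : Γ(M, U)) :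
    f.app V (M.presheaf.map (homOfLE i).op s) = N.presheaf.map (homOfLE i).op (f.app U s) :=
  congr($(f.mapPresheaf.naturality (homOfLE i).op) s)

/-- A complex of sheaves of modules is exact if every section of the kernel lifts locally. -/
theorem exact_of_locally_lifts (S : ShortComplex X.Modules)
    (h : ∀ (U : X.Opens) (s : Γ(S.X₂, U)), S.g.app U s = 0 → ∀ x ∈ U,
      ∃ (V : X.Opens) (i : V ≤ U) (t : Γ(S.X₁, V)), x ∈ V ∧
        S.f.app V t = S.X₂.presheaf.map (homOfLE i).op s) : S.Exact := by
  rw [ShortComplex.exact_iff_kernel_ι_comp_cokernel_π_zero]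
  ext U s
  -- The composite from the kernel of `S.g` to the cokernel of `S.f` kills a section as soon as that
  -- section is locally in the image of `S.f`.
  refine eq_zero_of_locally_eq_zero _ _ fun x hx => ?_
  have h0 : S.g.app U ((kernel.ι S.g).app U s) = 0 :=
    congr(Hom.app $(kernel.condition S.g) U s)
  obtain ⟨V, i, t, hxV, ht⟩ := h U _ h0 x hx
  refine ⟨V, i, hxV, ?_⟩
  rw [Hom.comp_app]
  change (cokernel S.f).presheaf.map (homOfLE i).op ((cokernel.π S.f).app U _) = 0
  refine (app_map _ _ _).symm.trans ((congrArg _ ht.symm).trans ?_)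
  exact congr(Hom.app $(cokernel.condition S.f) V t)

theorem sum_app {ι : Type*} (s : Finset ι) {M N : X.Modules} (f : ι → (M ⟶ N)) (U : X.Opens)
    (x : Γ(M, U)) : (∑ i ∈ s, f i).app U x = ∑ i ∈ s, (f i).app U x := by
  classical
  induction s using Finset.induction_on with
  | empty => simp
  | insert i s hi ih => simp [Finset.sum_insert hi, ih]

theorem zsmul_app {M N : X.Modules} (n : ℤ) (f : M ⟶ N) (U : X.Opens)
    (x : Γ(M, U)) : (n • f).app U x = n • f.app U x :=
  map_zsmul (⟨⟨fun f : M ⟶ N => f.app U x, rfl⟩, fun _ _ => rfl⟩ : (M ⟶ N) →+ Γ(N, U)) n f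

/-! ### Sections of a finite biproduct are tuples of sections. -/

section Biproduct

variable {ι : Type} [Finite ι] (M : ι → X.Modules)

theorem biproduct_section_ext {U : X.Opens} {s t : Γ(⨁ M, U)}
    (h : ∀ i, (biproduct.π M i).app U s = (biproduct.π M i).app U t) : s = t := by
  have := Fintype.ofFinite ι
  have key (s : Γ(⨁ M, U)) :
      s = ∑ i, (biproduct.ι M i).app U ((biproduct.π M i).app U s) := by
    have e : (∑ i, biproduct.π M i ≫ biproduct.ι M i).app U s = s := by
      rw [biproduct.total]; rfl
    rw [sum_app] at e
    exact e.symm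
  rw [key s, key t]
  simp only [h]

theorem exists_biproduct_section {U : X.Opens} (s : ∀ i, Γ(M i, U)) :
    ∃ t : Γ(⨁ M, U), ∀ i, (biproduct.π M i).app U t = s i := by
  classical
  have := Fintype.ofFinite ι
  refine ⟨∑ i, (biproduct.ι M i).app U (s i), fun j => ?_⟩
  rw [map_sum, Finset.sum_eq_single j]
  · exact congr(Hom.app $(biproduct.ι_π_self M j) U (s j))
  · intro i _ hij
    exact congr(Hom.app $(biproduct.ι_π_ne M hij) U (s i))
  · simp

end Biproduct

end AlgebraicGeometry.Scheme.Modules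

/-! ### From exact families of ideals to exactness of the sheaf sequence. -/

namespace MayerVietoris

open Scheme Scheme.Modules

variable {X : Scheme.{0}}

/-- The restriction of functions `𝒪_X(U) ⟶ 𝒪_Z(U)` to the closed subscheme `Z` with ideal
sheaf `I`. -/
def toStructureModule (I : X.IdealSheafData) (U : X.Opens) :
    Γ(X, U) →+ Γ(structureModule I, U) :=
  (I.subschemeι.app U).hom.toAddMonoidHom

theorem toStructureModule_surjective (I : X.IdealSheafData) (U : X.affineOpens) :
    Function.Surjective (toStructureModule I U) :=
  I.subschemeι_app_surjective U

theorem toStructureModule_eq_zero_iff (I : X.IdealSheafData) (U : X.affineOpens)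
    (a : Γ(X, U.1)) : toStructureModule I U a = 0 ↔ a ∈ I.ideal U := by
  rw [← I.ker_subschemeι_app U]
  rfl

theorem restrictionMap_toStructureModule {I J : X.IdealSheafData} (h : I ≤ J) (U : X.Opens)
    (a : Γ(X, U)) :
    (restrictionMap h).app U (toStructureModule I U a) = toStructureModule J U a := by
  have e : I.subschemeι.app U ≫ (IdealSheafData.inclusion h).appLE (I.subschemeι ⁻¹ᵁ U)
      (J.subschemeι ⁻¹ᵁ U) (preimage_le_preimage h U) = J.subschemeι.app U := by
    simp only [Scheme.Hom.app_eq_appLE, Scheme.Hom.appLE_comp_appLE,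
      IdealSheafData.inclusion_subschemeι]
  exact congr($e a)

variable {r : ℕ} (I : Fin r → X.IdealSheafData)

theorem interIdeal_ideal {p : ℕ} (c : Fin (p + 1) ↪o Fin r) (U : X.affineOpens) :
    (interIdeal I c).ideal U = ⨆ k, (I (c k)).ideal U := by
  simp [interIdeal]

theorem unionIdeal_ideal (U : X.affineOpens) : (unionIdeal I).ideal U = ⨅ i, (I i).ideal U := by
  simp [unionIdeal]

/-- Translates the sheaf differential into `coboundary` on representatives in `Γ(X, U)`. -/
theorem π_differential_app {p : ℕ} (c : Fin (p + 2) ↪o Fin r) (U : X.Opens) (s : Γ(term I p, U))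
    (φ : (Fin (p + 1) ↪o Fin r) → Γ(X, U))
    (hφ : ∀ b, (biproduct.π _ b : term I p ⟶ _).app U s = toStructureModule _ U (φ b)) :
    (biproduct.π _ c : term I (p + 1) ⟶ _).app U ((differential I p).app U s) =
      toStructureModule _ U (coboundary φ c) := by
  have e : differential I p ≫ biproduct.π _ c = _ := biproduct.lift_π _ c
  refine (congr(Hom.app $e U s)).trans ?_
  rw [sum_app, map_coboundary]
  refine Finset.sum_congr rfl fun j _ => ?_
  rw [zsmul_app]
  congr 1
  refine (congrArg ((restrictionMap (interIdeal_dropIndex_le I c j)).app U)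
    (hφ (dropIndex c j))).trans ?_
  exact restrictionMap_toStructureModule _ _ _

theorem π_augmentation_app (c : Fin 1 ↪o Fin r) (U : X.Opens) (a : Γ(X, U)) :
    (biproduct.π _ c : term I 0 ⟶ _).app U ((augmentation I).app U (toStructureModule _ U a)) =
      toStructureModule _ U a := by
  have e : augmentation I ≫ biproduct.π _ c = _ := biproduct.lift_π _ c
  exact (congr(Hom.app $e U (toStructureModule _ U a))).trans
    (restrictionMap_toStructureModule _ _ _)

/-- The Mayer–Vietoris sequence is exact if every point has arbitrarily small affine neighbourhoods
on which the ideals form an exact family. -/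
theorem sheafSequence_acyclic
    (h : ∀ (U : X.Opens), ∀ x ∈ U, ∃ V : X.affineOpens, V.1 ≤ U ∧ x ∈ V.1 ∧
      IsExactFamily fun i => (I i).ideal V) : (sheafSequence I).Acyclic := by
  have lift {p : ℕ} (V : X.affineOpens) (s : Γ(term I p, V.1)) :
      ∃ φ : (Fin (p + 1) ↪o Fin r) → Γ(X, V.1), ∀ b,
        (biproduct.π _ b : term I p ⟶ _).app V.1 s = toStructureModule _ V.1 (φ b) := by
    choose φ hφ using fun b => toStructureModule_surjective (interIdeal I b) V
      ((biproduct.π _ b : term I p ⟶ _).app V.1 s)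
    exact ⟨φ, fun b => (hφ b).symm⟩
  have key {p : ℕ} {U : X.Opens} (s : Γ(term I p, U)) (hs : (differential I p).app U s = 0)
      {x : X} (hx : x ∈ U) : ∃ (V : X.affineOpens) (i : V.1 ≤ U),
      x ∈ V.1 ∧ ∃ ψ : (Fin p ↪o Fin r) → Γ(X, V.1), ∀ b,
        (biproduct.π _ b : term I p ⟶ _).app V.1 ((term I p).presheaf.map (homOfLE i).op s) =
          toStructureModule _ V.1 (coboundary ψ b) := by
    obtain ⟨V, i, hxV, hV⟩ := h U x hx
    obtain ⟨φ, hφ⟩ := lift V ((term I p).presheaf.map (homOfLE i).op s)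
    obtain ⟨ψ, hψ⟩ := hV p φ fun c => by
      rw [← interIdeal_ideal, ← toStructureModule_eq_zero_iff, ← π_differential_app I c _ _ φ hφ,
        app_map, hs, map_zero, map_zero]
    refine ⟨V, i, hxV, ψ, fun b => (hφ b).trans ?_⟩
    rw [← sub_eq_zero, ← map_sub, toStructureModule_eq_zero_iff, interIdeal_ideal]
    exact hψ b
  intro n
  obtain _ | _ | p := n
  -- Injectivity at `𝒪_D`: a representative that vanishes on every `D_j` lies in every ideal, hence
  -- in their infimum.
  · rw [HomologicalComplex.exactAt_iff' _ 0 0 1 (by simp) (by simp)]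
    refine exact_of_locally_lifts _ fun U (s : Γ(structureModule (unionIdeal I), U)) hs x hx => ?_
    obtain ⟨V, i, hxV, -⟩ := h U x hx
    refine ⟨V.1, i, 0, hxV, ?_⟩
    rw [map_zero]
    change (augmentation I).app U s = 0 at hs
    change 0 = (structureModule (unionIdeal I)).presheaf.map (homOfLE i).op s
    obtain ⟨a, ha⟩ := toStructureModule_surjective _ V
      ((structureModule (unionIdeal I)).presheaf.map (homOfLE i).op s)
    rw [← ha, eq_comm, toStructureModule_eq_zero_iff, unionIdeal_ideal, Ideal.mem_iInf]
    intro j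
    let c : Fin 1 ↪o Fin r := OrderEmbedding.ofStrictMono (fun _ => j) (Subsingleton.strictMono _)
    have e := π_augmentation_app I c V a
    rw [ha, app_map, hs, map_zero, map_zero, eq_comm, toStructureModule_eq_zero_iff,
      interIdeal_ideal] at e
    exact (iSup_le fun _ => le_rfl : (⨆ k, (I (c k)).ideal V) ≤ (I j).ideal V) e
  · rw [HomologicalComplex.exactAt_iff' _ 0 1 2 (by simp) (by simp)]
    refine exact_of_locally_lifts _ fun U s hs x hx => ?_
    have hd : (sheafSequence I).d 1 2 = differential I 0 :=
      CochainComplex.of_d (term I) (differential I) 0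
    change ((sheafSequence I).d 1 2).app U s = 0 at hs
    rw [hd] at hs
    obtain ⟨V, i, hxV, ψ, hψ⟩ := key s hs hx
    -- Here `ψ` lives on the single empty tuple, so it is one function on `V`, and its restriction
    -- to `D` is the lift.
    refine ⟨V.1, i, toStructureModule _ V.1 (ψ (Fin.castLEOrderEmb (Nat.zero_le r))), hxV, ?_⟩
    refine biproduct_section_ext _ fun c => ((π_augmentation_app I c V.1 _).trans ?_).trans
      (hψ c).symm
    simp only [coboundary, Fin.sum_univ_succ, Fin.val_zero, pow_zero, one_smul,
      Finset.univ_eq_empty, Finset.sum_empty, add_zero]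
    congr 2
    ext k
    exact k.elim0
  · rw [HomologicalComplex.exactAt_iff' _ (p + 1) (p + 2) (p + 3) (by simp) (by simp)]
    refine exact_of_locally_lifts _ fun U s hs x hx => ?_
    have hd : (sheafSequence I).d (p + 2) (p + 3) = differential I (p + 1) :=
      CochainComplex.of_d (term I) (differential I) (p + 1)
    have hd' : (sheafSequence I).d (p + 1) (p + 2) = differential I p :=
      CochainComplex.of_d (term I) (differential I) p
    change ((sheafSequence I).d (p + 2) (p + 3)).app U s = 0 at hs
    rw [hd] at hs
    obtain ⟨V, i, hxV, ψ, hψ⟩ := key s hs hx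
    obtain ⟨t, ht⟩ := exists_biproduct_section _ fun b => toStructureModule (interIdeal I b) V.1 (ψ b)
    refine ⟨V.1, i, t, hxV, ?_⟩
    change ((sheafSequence I).d (p + 1) (p + 2)).app V.1 t = _
    rw [hd']
    exact biproduct_section_ext _ fun c => (π_differential_app I c V.1 t ψ ht).trans (hψ c).symm

end MayerVietoris

/-! ## Torus-invariant closed subsets on the charts -/

/-- `f` and the canonical map from the spectrum of `Γ(X, f.opensRange)` are open immersions with the
same range, so they differ by an isomorphism of spectra, which matches points of `Z` with points of
its preimage. -/
theorem AlgebraicGeometry.exists_iso_vanishingIdeal_ideal_opensRange {X : Scheme.{0}}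
    {R : CommRingCat.{0}} (f : Spec R ⟶ X) [IsOpenImmersion f] :
    ∃ g : R ≅ Γ(X, f.opensRange), ∀ Z : Closeds X,
      (Scheme.IdealSheafData.vanishingIdeal Z).ideal ⟨f.opensRange, isAffineOpen_opensRange f⟩ =
        (PrimeSpectrum.vanishingIdeal (f ⁻¹' Z)).map g.hom.hom := by
  have hU := isAffineOpen_opensRange f
  let e := IsOpenImmersion.isoOfRangeEq hU.fromSpec f (by simp)
  let g : R ⟶ Γ(X, f.opensRange) := Spec.preimage e.hom
  have hg : Spec.map g = e.hom := Spec.map_preimage _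
  have hgf : Spec.map g ≫ f = hU.fromSpec := by
    rw [hg]
    exact IsOpenImmersion.isoOfRangeEq_hom_fac _ _ _
  have : IsIso (Spec.map g) := hg ▸ inferInstance
  have : IsIso g := (ConcreteCategory.isIso_iff_bijective g).2 (isIso_SpecMap_iff.1 this)
  refine ⟨asIso g, fun Z => ?_⟩
  have hsurj : Function.Surjective g.hom := (asIso g).commRingCatIsoToRingEquiv.surjective
  rw [Scheme.IdealSheafData.vanishingIdeal_ideal]
  ext x
  obtain ⟨y, rfl⟩ := hsurj x
  have hinj : Function.Injective g.hom := (asIso g).commRingCatIsoToRingEquiv.injective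
  change _ ↔ g.hom y ∈ Ideal.map g.hom _
  rw [Ideal.mem_map_iff_of_surjective _ hsurj]
  simp only [hinj.eq_iff, exists_eq_right, PrimeSpectrum.mem_vanishingIdeal]
  constructor
  · intro h q hq
    obtain ⟨p, rfl⟩ := (Spec.map g).surjective q
    refine h p ?_
    change hU.fromSpec p ∈ Z
    rw [← hgf]
    exact hq
  · intro h (p : Spec Γ(X, f.opensRange)) hp
    refine h (Spec.map g p) ?_
    change f (Spec.map g p) ∈ Z
    rw [← Scheme.Hom.comp_apply, hgf]
    exact hp

namespace Toric

open MayerVietoris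

variable {n : ℕ}

theorem character_injective {m m' : Fin n → ℤ}
    (h : ∀ t : Fin n → ℂˣ, character t m = character t m') : m = m' := by
  funext i
  have h2 : (2 : ℂ) ≠ 0 := two_ne_zero
  -- At the point with `i`-th coordinate `2` and all others `1`, the character takes the value `2 ^
  -- m i`.
  have := h (Function.update 1 i (Units.mk0 2 h2))
  have key (m : Fin n → ℤ) :
      (character (Function.update 1 i (Units.mk0 2 h2)) m : ℂ) = 2 ^ m i := by
    rw [character, Finset.prod_eq_single i]
    · simp
    · intro j _ hj
      simp [Function.update_of_ne hj]
    · simp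
  have e := congrArg (fun u : ℂˣ => ‖(u : ℂ)‖) this
  simp only [key, norm_zpow, Complex.norm_ofNat] at e
  exact zpow_right_injective₀ (by norm_num) (by norm_num) e

/-- The character `χ^m` as a homomorphism from the torus to `ℂ`. -/
def characterHom (m : Fin n → ℤ) : (Fin n → ℂˣ) →* ℂ where
  toFun t := character t m
  map_one' := by simp [character]
  map_mul' t t' := by simp [character, mul_zpow, Finset.prod_mul_distrib]

/-- Dedekind's independence of characters, applied to the pairwise distinct `χ^m`. -/
theorem linearIndependent_characterHom :
    LinearIndependent ℂ fun m : Fin n → ℤ => (characterHom m : (Fin n → ℂˣ) → ℂ) :=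
  (linearIndependent_monoidHom (Fin n → ℂˣ) ℂ).comp characterHom fun _ _ h =>
    character_injective fun t => Units.ext (DFunLike.congr_fun h t)

/-- Torus-invariant ideals of a chart are spanned by characters. -/
theorem isMonomialIdeal_of_chartActionRingHom_mem {σ : PointedCone ℝ (Fin n → ℝ)}
    {I : Ideal (chartRing σ)} (hI : ∀ t, ∀ f ∈ I, chartActionRingHom t σ f ∈ I) :
    IsMonomialIdeal I := by
  intro f hf m hm
  let W := I.restrictScalars ℂ
  by_contra hmI
  -- Separate `χ^m` from `I` by a linear functional `l` that vanishes on `I`. Applied to the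
  -- translates of `f`, it gives a linear relation among characters with coefficients `f_m l(χ^m)`,
  -- which must all vanish.
  obtain ⟨l, hl, hlW⟩ := Submodule.exists_le_ker_of_notMem (p := W) hmI
  have key : ∑ m ∈ f.coeff.support,
      (f.coeff m * l (AddMonoidAlgebra.single m 1)) • (characterHom m.1 : (Fin n → ℂˣ) → ℂ) = 0 := by
    funext t
    have e : l (chartActionRingHom t σ f) = 0 := hlW (hI t f hf)
    rw [← AddMonoidAlgebra.sum_coeff_single f, Finsupp.sum, map_sum, map_sum] at e
    rw [Finset.sum_apply, Pi.zero_apply, ← e]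
    refine Finset.sum_congr rfl fun m _ => ?_
    have : AddMonoidAlgebra.single m (f.coeff m * (character t m : ℂ)) =
        (f.coeff m * (character t m : ℂ)) • (AddMonoidAlgebra.single m 1 : chartRing σ) := by
      simp
    rw [chartActionRingHom_single, this, map_smul]
    simp only [Pi.smul_apply, smul_eq_mul]
    change _ * (character t m : ℂ) = _
    ring
  have li := linearIndependent_characterHom.comp (fun m : dualMonoid σ => m.1)
    Subtype.val_injective
  have := linearIndependent_iff'.1 li _ _ key m hm
  rcases mul_eq_zero.1 this with h | h
  · exact Finsupp.mem_support_iff.1 hm h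
  · exact hl h

/-! ### Exactness on the charts of the toric variety. -/

namespace Fan

variable (F : Fan n)

/-- The inclusion of the chart `U_σ`. -/
def chartι (σ : F.Cone) : Spec (.of (chartRing σ.1)) ⟶ F.toricVariety := colimit.ι F.charts σ

instance (σ : F.Cone) : IsOpenImmersion (F.chartι σ) :=
  inferInstanceAs (IsOpenImmersion (colimit.ι F.charts σ))

theorem exists_chartι_eq (x : F.toricVariety) : ∃ σ y, F.chartι σ y = x :=
  Scheme.IsLocallyDirected.ι_jointly_surjective F.charts x

theorem chartι_torusAction (t : Fin n → ℂˣ) (σ : F.Cone) :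
    F.chartι σ ≫ F.torusAction t =
      Spec.map (CommRingCat.ofHom (chartActionRingHom t σ.1).toRingHom) ≫ F.chartι σ :=
  ι_colimMap _ _

variable {F} in
theorem IsTorusInvariant.isMonomialIdeal_vanishingIdeal {Z : Set F.toricVariety}
    (hZ : F.IsTorusInvariant Z) (σ : F.Cone) :
    IsMonomialIdeal (PrimeSpectrum.vanishingIdeal (F.chartι σ ⁻¹' Z)) := by
  refine isMonomialIdeal_of_chartActionRingHom_mem fun t f hf => ?_
  rw [PrimeSpectrum.mem_vanishingIdeal] at hf ⊢
  intro (x : Spec (.of (chartRing σ.1))) hx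
  -- The translate of `f` vanishes at `x` when `f` vanishes at `t · x`, which lies in `Z` again.
  refine hf (Spec.map (CommRingCat.ofHom (chartActionRingHom t σ.1).toRingHom) x) ?_
  change F.chartι σ
    (Spec.map (CommRingCat.ofHom (chartActionRingHom t σ.1).toRingHom) x) ∈ Z
  rw [← Scheme.Hom.comp_apply, ← chartι_torusAction, Scheme.Hom.comp_apply]
  exact hZ t ⟨_, hx, rfl⟩

variable {F} in
theorem isExactFamily_vanishingIdeal_opensRange_chartι {r : ℕ} {Z : Fin r → Closeds F.toricVariety}
    (hZ : ∀ i, F.IsTorusInvariant (Z i)) (σ : F.Cone) :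
    IsExactFamily fun i => (Scheme.IdealSheafData.vanishingIdeal (Z i)).ideal
      ⟨(F.chartι σ).opensRange, isAffineOpen_opensRange _⟩ := by
  obtain ⟨g, hg⟩ := exists_iso_vanishingIdeal_ideal_opensRange (F.chartι σ)
  simp only [hg]
  let := g.hom.hom.toAlgebra
  -- An isomorphism is a localization at the trivial submonoid, so exactness is transported by the
  -- localization lemma.
  have : IsLocalization (⊥ : Submonoid (chartRing σ.1))
      Γ(F.toricVariety, (F.chartι σ).opensRange) :=
    IsLocalization.of_le_isUnit_of_bijective
      (by rintro _ ⟨x, hx, rfl⟩; obtain rfl := Submonoid.mem_bot.1 hx; simp)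
      g.commRingCatIsoToRingEquiv.bijective
  exact (isExactFamily_of_isMonomialIdeal fun i =>
    (hZ i).isMonomialIdeal_vanishingIdeal σ).localization ⊥ _

end Fan

end Toric

theorem MayerVietoris.IsExactFamily.basicOpen {X : Scheme.{0}} {r : ℕ}
    {I : Fin r → X.IdealSheafData} {U : X.affineOpens}
    (h : IsExactFamily fun i => (I i).ideal U) (f : Γ(X, U.1)) :
    IsExactFamily fun i => (I i).ideal (X.affineBasicOpen f) := by
  have := U.2.isLocalization_basicOpen f
  simp only [← fun i => (I i).map_ideal_basicOpen U f]
  exact h.localization (.powers f) Γ(X, X.basicOpen f)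

end

theorem mainTheorem6 {n : ℕ} (F : Toric.Fan n) (hF : F.IsSimplicial) {r : ℕ}
    (D : Fin r → IrreducibleCloseds F.toricVariety)
    (hD : ∀ i, IsPrimeDivisor (D i))
    (hT : ∀ i, F.IsTorusInvariant (D i)) :
    (MayerVietoris.sheafSequence fun i => reducedIdeal (D i)).Acyclic := by
  refine MayerVietoris.sheafSequence_acyclic _ fun U x hx => ?_
  obtain ⟨σ, y, rfl⟩ := F.exists_chartι_eq x
  have hy : F.chartι σ y ∈ (F.chartι σ).opensRange := ⟨y, rfl⟩
  -- Basic opens of a chart give arbitrarily small affine neighbourhoods, and exactness passes to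
  -- them by localization.
  obtain ⟨f, hf, hxf⟩ := (isAffineOpen_opensRange (F.chartι σ)).exists_basicOpen_le ⟨_, hx⟩ hy
  have hZ := Toric.Fan.isExactFamily_vanishingIdeal_opensRange_chartι
    (Z := fun i => ⟨D i, (D i).isClosed⟩) hT σ
  exact ⟨F.toricVariety.affineBasicOpen (U := ⟨_, isAffineOpen_opensRange (F.chartι σ)⟩) f, hf, hxf,
    hZ.basicOpen f⟩
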